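/- For integers $m\ge 3$ let $\mathcal P_m=\left\{\frac{(m-2)x^2-(m-4)x}{2} : x\in\mathbb Z,\ x\ge 0\right\}$ be the set of $m$-gonal numbers. For a vector $\mathbf a=(a_1,\dots,a_k)$ of positive integers, the sum of $m$-gonal numbers $(\mathcal P_m,\mathbf a)$ is called tight $\mathcal T(n)$-universal if $$\{a_1s_1+\cdots+a_ks_k : s_1,\dots,s_k\in\mathcal P_m\}\setminus\{0\}=\mathcal T(n):=\{N\in\mathbb Z : N\ge n\},$$ and it is called new if, moreover, $(\mathcal P_m,\mathbf b)$ is not tight $\mathcal T(n)$-universal for any proper subsequence $\mathbf b$ of $\mathbf a$. Let $m\ge 3$ and $n\ge 2m+3$ be integers. Then, up to reordering the entries of $\mathbf a$, there are exactly two new tight $\mathcal T(n)$-universal sums of $m$-gonal numbers $(\mathcal P_m,\mathbf a)$, namely those with $$\mathbf a=\mathbf x_n=(n,n,n+1,n+2,\dots,2n-1)\quad\text{and}\quad \mathbf a=\mathbf y_n=(n,n+1,n+2,\dots,2n).$$ That is, $\mathbf x_n$ and $\mathbf y_n$ are not rearrangements of each other, and $(\mathcal P_m,\mathbf a)$ is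 new tight $\mathcal T(n)$-universal if and only if $\mathbf a$ is a rearrangement of $\mathbf x_n$ or of $\mathbf y_n$. -/

import Mathlib

namespace PolygonalSums

/-- The set of `m`-gonal numbers: all `((m - 2) x² - (m - 4) x) / 2` with `x` a nonnegative integer
(the division is carried out in `ℚ`; the values are natural numbers for `m ≥ 3`). -/
def polygonalNumbers (m : ℕ) : Set ℕ :=
  {N | ∃ x : ℕ, (N : ℚ) = (((m : ℚ) - 2) * (x : ℚ) ^ 2 - ((m : ℚ) - 4) * (x : ℚ)) / 2}

/-- `V_S(a) = {a₁ s₁ + ⋯ + a_k s_k : s_i ∈ S}` for a vector `a = (a₁, …, a_k)`. -/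
def V (S : Set ℕ) (a : List ℕ) : Set ℕ :=
  {N | ∃ s : Fin a.length → ℕ, (∀ i, s i ∈ S) ∧ N = ∑ i, a.get i * s i}

/-- `V'_S(a) = V_S(a) \ {0}`. -/
def V' (S : Set ℕ) (a : List ℕ) : Set ℕ := V S a \ {0}

/-- `T(n)`: the set of integers greater than or equal to `n`. -/
def T (n : ℕ) : Set ℕ := {N | n ≤ N}

/-- `b ≺ a`: `b` is a proper subsequence of `a`. -/
def ProperSubseq (b a : List ℕ) : Prop := b.Sublist a ∧ b ≠ a

/-- `a` is a vector of positive integers and the sum of `m`-gonal numbers `(P_m, a)` is tight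
`T(n)`-universal. -/
def IsTightUniversal (m n : ℕ) (a : List ℕ) : Prop :=
  (∀ c ∈ a, 0 < c) ∧ V' (polygonalNumbers m) a = T n

/-- `(P_m, a)` is a new tight `T(n)`-universal sum of `m`-gonal numbers. -/
def IsNewTightUniversal (m n : ℕ) (a : List ℕ) : Prop :=
  IsTightUniversal m n a ∧ ∀ b : List ℕ, ProperSubseq b a → ¬ IsTightUniversal m n b

/-- `x_n = (n, n, n + 1, n + 2, …, 2n - 1)`. -/
def xVec (n : ℕ) : List ℕ := n :: List.range' n n

/-- `y_n = (n, n + 1, n + 2, …, 2n)`. -/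
def yVec (n : ℕ) : List ℕ := List.range' n (n + 1)

end PolygonalSums

/-!
A positive definite integral ternary form of determinant `1` is a sum of three squares of integral
linear forms, by reduction of the form. Choosing such a form suitably, with the help of Dirichlet's
theorem and quadratic reciprocity, gives Gauss's theorem that every `n ≡ 3 (mod 8)` is a sum of
three squares; Cauchy's lemma and Fermat's polygonal number theorem follow.

If the weights `i` and `3n - i` carry the same `m`-gonal number `s`, they contribute `3n * s`. Among
`n + 1, …, 2n - 1` there are at least `m + 1` such pairs, so that all multiples of `3n` are
represented, even after one weight `u` has been set aside. The two remaining weights, `n, n` or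
`n, 2n`, add any of `0, n, 2n`, which gives all multiples of `n`, and `u` adjusts the residue
modulo `n`.

Conversely, all weights of a tight sum are at least `n`, and `2` is not `m`-gonal, so that a number
less than `3n` is represented only as a sum of some of the weights. Applied to `n, …, 2n - 1` and
`2n`, this forces `x_n` or `y_n` to occur in the sum.
-/

namespace PolygonalSums

section SumThreeSquares

open Matrix

/-- `G` is the Gram matrix of the columns of an integral matrix, that is, the quadratic form with
matrix `G` is a sum of squares of integral linear forms. -/
def IsIntegralGram {ι : Type*} [Fintype ι] (G : Matrix ι ι ℤ) : Prop :=
  ∃ P : Matrix ι ι ℤ, Pᵀ * P = G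

theorem IsIntegralGram.of_congruence {ι : Type*} [Fintype ι] [DecidableEq ι] {G U : Matrix ι ι ℤ}
    (hU : IsUnit U.det) (h : IsIntegralGram (Uᵀ * G * U)) : IsIntegralGram G := by
  obtain ⟨P, hP⟩ := h
  refine ⟨P * U⁻¹, ?_⟩
  calc (P * U⁻¹)ᵀ * (P * U⁻¹) = U⁻¹ᵀ * (Pᵀ * P) * U⁻¹ := by
        simp only [transpose_mul, Matrix.mul_assoc]
    _ = (U * U⁻¹)ᵀ * G * (U * U⁻¹) := by simp only [hP, transpose_mul, Matrix.mul_assoc]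
    _ = G := by rw [mul_nonsing_inv U hU, transpose_one, Matrix.one_mul, Matrix.mul_one]

theorem IsIntegralGram.of_submatrix {ι : Type*} [Fintype ι] {G : Matrix ι ι ℤ} (e : ι ≃ ι)
    (h : IsIntegralGram (G.submatrix e e)) : IsIntegralGram G := by
  obtain ⟨P, hP⟩ := h
  refine ⟨P.submatrix e.symm e.symm, ?_⟩
  rw [transpose_submatrix, submatrix_mul_equiv, hP, submatrix_submatrix]
  simp

/-- The determinant of the restriction of the form `G` to the basis vectors `i` and `j`. -/
def principalMinor (G : Matrix (Fin 3) (Fin 3) ℤ) (i j : Fin 3) : ℤ := G i i * G j j - G i j ^ 2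

theorem principalMinor_comm {G : Matrix (Fin 3) (Fin 3) ℤ} (hG : G.IsSymm) (i j : Fin 3) :
    principalMinor G i j = principalMinor G j i := by
  rw [principalMinor, principalMinor, mul_comm, hG.apply i j]

theorem exists_two_mul_abs_add_mul_le (x : ℤ) {y : ℤ} (hy : 0 < y) :
    ∃ k : ℤ, 2 * |x + k * y| ≤ y := by
  refine ⟨-((2 * x + y) / (2 * y)), ?_⟩
  have hdiv := Int.emod_add_mul_ediv (2 * x + y) (2 * y)
  have hnonneg := Int.emod_nonneg (2 * x + y) (by positivity : 2 * y ≠ 0)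
  have hlt := Int.emod_lt_of_pos (2 * x + y) (by positivity : 0 < 2 * y)
  rw [← abs_of_pos (two_pos (α := ℤ)), ← abs_mul, abs_of_pos (two_pos (α := ℤ)), abs_le]
  constructor <;> linarith

/-- A form reduced in the sense of Hermite: both Gram–Schmidt coefficients `μ₁₀`, `μ₂₁` of its basis
have absolute value at most `1 / 2` (with denominators cleared). -/
structure IsSizeReduced (G : Matrix (Fin 3) (Fin 3) ℤ) : Prop where
  two_mul_abs_le : 2 * |G 0 1| ≤ G 0 0
  two_mul_abs_le_principalMinor : 2 * |G 0 0 * G 1 2 - G 0 2 * G 0 1| ≤ principalMinor G 0 1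

theorem exists_congruence_isSizeReduced {G : Matrix (Fin 3) (Fin 3) ℤ} (hG : G.IsSymm)
    (hpos : 0 < G 0 0) (hminor : 0 < principalMinor G 0 1) :
    ∃ U H : Matrix (Fin 3) (Fin 3) ℤ, U.det = 1 ∧ H = Uᵀ * G * U ∧ IsSizeReduced H ∧
      H 0 0 = G 0 0 ∧ principalMinor H 0 1 = principalMinor G 0 1 := by
  obtain ⟨k, hk⟩ := exists_two_mul_abs_add_mul_le (G 0 1) hpos
  obtain ⟨l, hl⟩ := exists_two_mul_abs_add_mul_le (G 0 0 * G 1 2 - G 0 2 * G 0 1) hminor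
  set U : Matrix (Fin 3) (Fin 3) ℤ := !![1, k, 0; 0, 1, l; 0, 0, 1] with hU
  have h10 : G 1 0 = G 0 1 := hG.apply 0 1
  have h00 : (Uᵀ * G * U) 0 0 = G 0 0 := by
    simp [hU, Matrix.mul_apply, Fin.sum_univ_three]
  have h01 : (Uᵀ * G * U) 0 1 = G 0 1 + k * G 0 0 := by
    simp [hU, Matrix.mul_apply, Fin.sum_univ_three]; ring
  have h02 : (Uᵀ * G * U) 0 2 = G 0 2 + l * G 0 1 := by
    simp [hU, Matrix.mul_apply, Fin.sum_univ_three]; ring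
  have h11 : (Uᵀ * G * U) 1 1 = G 1 1 + 2 * k * G 0 1 + k ^ 2 * G 0 0 := by
    simp [hU, Matrix.mul_apply, Fin.sum_univ_three, h10]; ring
  have h12 : (Uᵀ * G * U) 1 2 = G 1 2 + l * G 1 1 + k * G 0 2 + k * l * G 0 1 := by
    simp [hU, Matrix.mul_apply, Fin.sum_univ_three]; ring
  have hminor_eq : principalMinor (Uᵀ * G * U) 0 1 = principalMinor G 0 1 := by
    rw [principalMinor, h00, h01, h11, principalMinor]; ring
  refine ⟨U, _, by simp [hU, det_fin_three], rfl, ⟨by rwa [h00, h01], ?_⟩, h00, hminor_eq⟩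
  rw [hminor_eq, h00, h01, h02, h12]
  convert hl using 3
  rw [principalMinor]; ring

/-- Jacobi's identity for the complementary minors of `G`. -/
theorem principalMinor_mul_principalMinor {G : Matrix (Fin 3) (Fin 3) ℤ} (hG : G.IsSymm) :
    principalMinor G 0 1 * principalMinor G 0 2 =
      G 0 0 * G.det + (G 0 0 * G 1 2 - G 0 2 * G 0 1) ^ 2 := by
  rw [det_fin_three, hG.apply 0 1, hG.apply 0 2, hG.apply 1 2, principalMinor, principalMinor]
  ring

theorem IsSizeReduced.eq_one_of_det_eq_one {G : Matrix (Fin 3) (Fin 3) ℤ} (hred : IsSizeReduced G)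
    (hG : G.IsSymm) (hpos : 0 < G 0 0) (hminor : 0 < principalMinor G 0 1) (hdet : G.det = 1)
    (hle : G 0 0 ≤ G 1 1) (hminor_le : principalMinor G 0 1 ≤ principalMinor G 0 2) :
    G 0 0 = 1 ∧ principalMinor G 0 1 = 1 := by
  obtain ⟨h₁, h₂⟩ := hred
  have hjacobi := principalMinor_mul_principalMinor hG
  have hsq₁ : 4 * G 0 1 ^ 2 ≤ G 0 0 ^ 2 := by
    rw [← sq_abs (G 0 1)]; nlinarith [abs_nonneg (G 0 1)]
  have hsq₂ : 4 * (G 0 0 * G 1 2 - G 0 2 * G 0 1) ^ 2 ≤ principalMinor G 0 1 ^ 2 := by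
    rw [← sq_abs (_ - _)]; nlinarith [abs_nonneg (G 0 0 * G 1 2 - G 0 2 * G 0 1)]
  have hbound₁ : 3 * G 0 0 ^ 2 ≤ 4 * principalMinor G 0 1 := by
    have : principalMinor G 0 1 = G 0 0 * G 1 1 - G 0 1 ^ 2 := rfl
    nlinarith
  have hbound₂ : 3 * principalMinor G 0 1 ^ 2 ≤ 4 * G 0 0 := by
    rw [hdet, mul_one] at hjacobi
    nlinarith
  have h00 : G 0 0 = 1 := by
    by_contra hne
    have : 2 ≤ G 0 0 := by omega
    nlinarith [mul_self_nonneg (G 0 0 - 2)]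
  exact ⟨h00, by nlinarith⟩

theorem IsSizeReduced.isIntegralGram {G : Matrix (Fin 3) (Fin 3) ℤ} (hred : IsSizeReduced G)
    (hG : G.IsSymm) (hdet : G.det = 1) (h00 : G 0 0 = 1) (hminor : principalMinor G 0 1 = 1) :
    IsIntegralGram G := by
  obtain ⟨h₁, h₂⟩ := hred
  have h01 : G 0 1 = 0 := by have := abs_nonneg (G 0 1); exact abs_eq_zero.mp (by omega)
  rw [hminor, h00, h01, mul_zero, sub_zero, one_mul] at h₂
  have h12 : G 1 2 = 0 := by have := abs_nonneg (G 1 2); exact abs_eq_zero.mp (by omega)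
  have h11 : G 1 1 = 1 := by simpa [principalMinor, h00, h01] using hminor
  have h22 : G 2 2 = G 0 2 ^ 2 + 1 := by
    rw [det_fin_three, hG.apply 0 1, hG.apply 0 2, hG.apply 1 2, h00, h01, h11, h12] at hdet
    linarith
  refine ⟨!![1, 0, G 0 2; 0, 1, 0; 0, 0, 1], ?_⟩
  ext i j
  fin_cases i <;> fin_cases j <;>
    simp [Matrix.mul_apply, Fin.sum_univ_three, hG.apply 0 1, hG.apply 0 2, hG.apply 1 2, h00, h01,
      h11, h12, h22, sq]

theorem isIntegralGram_of_det_eq_one {G : Matrix (Fin 3) (Fin 3) ℤ} (hG : G.IsSymm)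
    (hpos : 0 < G 0 0) (hminor : 0 < principalMinor G 0 1) (hdet : G.det = 1) :
    IsIntegralGram G := by
  obtain ⟨U, H, hU, hH, hred, h00, h01⟩ := exists_congruence_isSizeReduced hG hpos hminor
  refine .of_congruence (U := U) (hU ▸ isUnit_one) (hH ▸ ?_)
  have hHsymm : H.IsSymm := by
    rw [hH, IsSymm, transpose_mul, transpose_mul, transpose_transpose, hG.eq, Matrix.mul_assoc]
  have hHdet : H.det = 1 := by rw [hH, det_mul, det_mul, det_transpose, hU, hdet]; norm_num
  have hHpos : 0 < H 0 0 := h00 ▸ hpos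
  have hHminor : 0 < principalMinor H 0 1 := h01 ▸ hminor
  by_cases hlt : H 1 1 < H 0 0
  · refine .of_submatrix (Equiv.swap 0 1) <| isIntegralGram_of_det_eq_one (hHsymm.submatrix _) ?_ ?_
      ((det_submatrix_equiv_self _ _).trans hHdet)
    · change 0 < H 1 1
      rw [principalMinor] at hHminor
      nlinarith [sq_nonneg (H 0 1)]
    · exact hHminor.trans_eq (principalMinor_comm hHsymm 0 1)
  by_cases hminor_lt : principalMinor H 0 2 < principalMinor H 0 1
  · refine .of_submatrix (Equiv.swap 1 2) <| isIntegralGram_of_det_eq_one (hHsymm.submatrix _) hHpos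
      ?_ ((det_submatrix_equiv_self _ _).trans hHdet)
    have hjacobi := principalMinor_mul_principalMinor hHsymm
    rw [hHdet, mul_one] at hjacobi
    have hmul_pos : 0 < principalMinor H 0 1 * principalMinor H 0 2 := by rw [hjacobi]; positivity
    exact pos_of_mul_pos_right hmul_pos hHminor.le
  obtain ⟨hone, hminor_one⟩ := hred.eq_one_of_det_eq_one hHsymm hHpos hHminor hHdet
    (not_lt.mp hlt) (not_lt.mp hminor_lt)
  exact hred.isIntegralGram hHsymm hHdet hone hminor_one
termination_by ((G 0 0).toNat, (principalMinor G 0 1).toNat)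
decreasing_by
  · refine Prod.Lex.left _ _ ?_
    change (H 1 1).toNat < _
    omega
  · rw [← h00]
    refine Prod.Lex.right _ ?_
    change (principalMinor H 0 2).toNat < _
    omega

/-- `n` is a diagonal entry of a positive definite form of determinant `1` whose leading `2 × 2`
minor is `d`. -/
theorem exists_sum_three_squares_of_dvd {n d x : ℤ} (hd : 0 < d) (hn : 2 ≤ n)
    (h : d * n - 1 ∣ x ^ 2 + d) : ∃ u v w : ℤ, u ^ 2 + v ^ 2 + w ^ 2 = n := by
  obtain ⟨a, ha⟩ := h
  have hb : 0 < d * n - 1 := by nlinarith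
  have hapos : 0 < a := pos_of_mul_pos_right (ha ▸ by positivity) hb.le
  obtain ⟨P, hP⟩ := isIntegralGram_of_det_eq_one (G := !![a, x, 1; x, d * n - 1, 0; 1, 0, n])
    (by ext i j; fin_cases i <;> fin_cases j <;> rfl) hapos
    (by simp [principalMinor]; linarith)
    (by simp [det_fin_three]; linear_combination -n * ha)
  have h22 := congrFun₂ hP 2 2
  simp only [Matrix.mul_apply, Fin.sum_univ_three, transpose_apply, ← sq] at h22
  exact ⟨_, _, _, h22⟩

end SumThreeSquares

theorem exists_prime_two_mul_add_one_eq_mul {n : ℕ} (hn : n % 8 = 3) :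
    ∃ p d : ℕ, p.Prime ∧ p % 4 = 1 ∧ d % 8 = 1 ∧ 2 * p + 1 = d * n := by
  obtain ⟨k, rfl⟩ : ∃ k, n = 8 * k + 3 := ⟨n / 8, by omega⟩
  have hcop : Nat.Coprime (4 * k + 1) (4 * (8 * k + 3)) := by
    refine Nat.Coprime.mul_right ?_ ?_
    · simp
    · rw [show 8 * k + 3 = 1 + 2 * (4 * k + 1) by ring, Nat.coprime_add_mul_right_right]
      exact Nat.coprime_one_right _
  obtain ⟨p, hlt, hp, hmod⟩ :=
    Nat.forall_exists_prime_gt_and_modEq (4 * k + 1) (by omega) hcop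
  obtain ⟨v, hv⟩ := (Nat.modEq_iff_dvd' hlt.le).mp hmod.symm
  obtain rfl : p = 4 * k + 1 + 4 * (8 * k + 3) * v := by omega
  exact ⟨_, 8 * v + 1, hp, by rw [mul_assoc]; omega, by omega, by ring⟩

theorem isSquare_neg_zmod_of_two_mul_add_one_eq_mul {p d n : ℕ} [Fact p.Prime] (hp : p % 4 = 1)
    (hd : d % 8 = 1) (h : 2 * p + 1 = d * n) : IsSquare (-(d : ZMod p)) := by
  have hp_odd : Odd p := Nat.odd_iff.mpr (by omega)
  have hd_odd : Odd d := Nat.odd_iff.mpr (by omega)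
  have hneg_one : jacobiSym (2 * p : ℤ) d = 1 := by
    have h' : (2 * p : ℤ) = -1 + d * n := by
      have : (2 * p + 1 : ℤ) = d * n := mod_cast h
      linarith
    rw [h', jacobiSym.mod_left, Int.add_mul_emod_self_left, ← jacobiSym.mod_left,
      jacobiSym.at_neg_one hd_odd, ZMod.χ₄_nat_one_mod_four (by omega)]
  have htwo : jacobiSym 2 d = 1 := by
    rw [jacobiSym.at_two hd_odd, ZMod.χ₈_nat_mod_eight, hd]
    rfl
  have hlegendre : legendreSym p (-d) = 1 := by
    rw [jacobiSym.legendreSym.to_jacobiSym, jacobiSym.neg _ hp_odd, ZMod.χ₄_nat_one_mod_four hp,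
      one_mul, jacobiSym.quadratic_reciprocity_one_mod_four' hd_odd hp]
    rwa [jacobiSym.mul_left, htwo, one_mul] at hneg_one
  have hne : ((-d : ℤ) : ZMod p) ≠ 0 := fun h0 => by
    rw [(legendreSym.eq_zero_iff p _).mpr h0] at hlegendre
    exact zero_ne_one hlegendre
  simpa using (legendreSym.eq_one_iff p hne).mp hlegendre

theorem exists_two_mul_dvd_sq_add {p d : ℕ} (hp : Odd p) (hd : Odd d)
    (h : IsSquare (-(d : ZMod p))) : ∃ x : ℤ, (2 * p : ℤ) ∣ x ^ 2 + d := by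
  obtain ⟨y, hy⟩ := h
  obtain ⟨x, rfl⟩ := ZMod.intCast_surjective y
  have hdvd : (p : ℤ) ∣ x ^ 2 + d := by
    rw [← ZMod.intCast_zmod_eq_zero_iff_dvd]
    push_cast
    linear_combination -hy
  obtain ⟨z, hz_odd, hz⟩ : ∃ z : ℤ, Odd z ∧ (p : ℤ) ∣ z ^ 2 + d := by
    rcases Int.even_or_odd x with hx | hx
    · refine ⟨x + p, hx.add_odd (mod_cast hp), ?_⟩
      rw [show (x + p) ^ 2 + (d : ℤ) = x ^ 2 + d + p * (2 * x + p) by ring]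
      exact dvd_add hdvd (dvd_mul_right _ _)
    · exact ⟨x, hx, hdvd⟩
  have hcop : IsCoprime (2 : ℤ) p := Nat.isCoprime_iff_coprime.mpr (Nat.coprime_two_left.mpr hp)
  have htwo : (2 : ℤ) ∣ z ^ 2 + d := (hz_odd.pow.add_odd (mod_cast hd)).two_dvd
  exact ⟨z, hcop.mul_dvd htwo hz⟩

theorem exists_sum_three_squares_of_mod_eight {n : ℕ} (hn : n % 8 = 3) :
    ∃ u v w : ℤ, u ^ 2 + v ^ 2 + w ^ 2 = n := by
  obtain ⟨p, d, hp, hp4, hd, h⟩ := exists_prime_two_mul_add_one_eq_mul hn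
  have := Fact.mk hp
  obtain ⟨x, hx⟩ := exists_two_mul_dvd_sq_add (Nat.odd_iff.mpr (by omega))
    (Nat.odd_iff.mpr (by omega)) (isSquare_neg_zmod_of_two_mul_add_one_eq_mul hp4 hd h)
  have h' : (2 * p : ℤ) = d * n - 1 := eq_sub_of_add_eq (mod_cast h)
  exact exists_sum_three_squares_of_dvd (by omega) (by omega) (h' ▸ hx)

theorem odd_of_sum_three_squares_emod_eight {u v w : ℤ} (h : (u ^ 2 + v ^ 2 + w ^ 2) % 8 = 3) :
    Odd u ∧ Odd v ∧ Odd w := by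
  have hsq : ∀ x : ℤ, Odd x ∧ x ^ 2 % 8 = 1 ∨ x ^ 2 % 4 = 0 := by
    intro x
    rcases Int.even_or_odd x with ⟨y, rfl⟩ | hx
    · right; ring_nf; omega
    · have := Int.eight_dvd_sq_sub_one_of_odd hx
      exact .inl ⟨hx, by omega⟩
  rcases hsq u with ⟨hu, _⟩ | _ <;> rcases hsq v with ⟨hv, _⟩ | _ <;>
    rcases hsq w with ⟨hw, _⟩ | _ <;> first | exact ⟨hu, hv, hw⟩ | omega

theorem exists_odd_sum_three_squares {n : ℕ} (hn : n % 8 = 3) :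
    ∃ u v w : ℤ, (Odd u ∧ Odd v ∧ Odd w) ∧ u ^ 2 + v ^ 2 + w ^ 2 = n := by
  obtain ⟨u, v, w, h⟩ := exists_sum_three_squares_of_mod_eight hn
  exact ⟨u, v, w, odd_of_sum_three_squares_emod_eight (by omega), h⟩

theorem two_mul_choose_two_add (x : ℕ) : 2 * x.choose 2 + x = x ^ 2 := by
  have := (Nat.even_mul_pred_self x).two_dvd
  rw [Nat.choose_two_right, Nat.mul_div_cancel' this]
  cases x with
  | zero => rfl
  | succ x => rw [Nat.add_sub_cancel]; ring

theorem exists_sum_three_triangular (M : ℕ) :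
    ∃ x y z : ℕ, (x + 1).choose 2 + (y + 1).choose 2 + (z + 1).choose 2 = M := by
  obtain ⟨u, v, w, ⟨hu, hv, hw⟩, h⟩ := exists_odd_sum_three_squares (n := 8 * M + 3) (by omega)
  have htri : ∀ u : ℤ, Odd u → ∃ x : ℕ, u ^ 2 = 8 * ((x + 1).choose 2 : ℕ) + 1 := by
    intro u hu
    obtain ⟨x, hx⟩ := Int.natAbs_odd.mpr hu
    have hchoose : (2 * (x + 1).choose 2 + (x + 1) : ℤ) = (x + 1) ^ 2 :=
      mod_cast two_mul_choose_two_add (x + 1)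
    refine ⟨x, ?_⟩
    rw [← Int.natAbs_sq, hx]
    push_cast
    linear_combination -4 * hchoose
  obtain ⟨x, hx⟩ := htri u hu
  obtain ⟨y, hy⟩ := htri v hv
  obtain ⟨z, hz⟩ := htri w hw
  exact ⟨x, y, z, by omega⟩

theorem exists_odd_sum_three_squares_four_dvd {a b : ℕ} (ha : Odd a) (hb : Odd b)
    (hab : b ^ 2 < 4 * a) :
    ∃ u v w : ℤ, (Odd u ∧ Odd v ∧ Odd w) ∧ 4 ∣ b + u + v + w ∧
      u ^ 2 + v ^ 2 + w ^ 2 = 4 * a - b ^ 2 := by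
  have hmod : (4 * a - b ^ 2) % 8 = 3 := by
    have := Nat.eight_dvd_sq_sub_one_of_odd hb
    have := pow_pos hb.pos 2
    obtain ⟨c, rfl⟩ := ha
    omega
  obtain ⟨u, v, w, hodd, h⟩ := exists_odd_sum_three_squares hmod
  rw [Nat.cast_sub hab.le] at h
  push_cast at h
  by_cases hdvd : 4 ∣ b + u + v + w
  · exact ⟨u, v, w, hodd, hdvd, h⟩
  · refine ⟨u, v, -w, ⟨hodd.1, hodd.2.1, hodd.2.2.neg⟩, ?_, by rwa [neg_sq]⟩
    obtain ⟨⟨u', rfl⟩, ⟨v', rfl⟩, ⟨w', rfl⟩⟩ := hodd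
    obtain ⟨b', rfl⟩ := hb
    omega

/-- **Cauchy's lemma**. -/
theorem exists_sum_four_squares_and_sum_eq {a b : ℕ} (ha : Odd a) (hb : Odd b)
    (hlower : 3 * a < b ^ 2 + 2 * b + 4) (hupper : b ^ 2 < 4 * a) :
    ∃ x y z w : ℕ, x ^ 2 + y ^ 2 + z ^ 2 + w ^ 2 = a ∧ x + y + z + w = b := by
  obtain ⟨u, v, w, ⟨hu, hv, hw⟩, hdvd, h⟩ := exists_odd_sum_three_squares_four_dvd ha hb hupper
  have hlt : ∀ r s t : ℤ, r ^ 2 + s ^ 2 + t ^ 2 = 4 * a - b ^ 2 → -(b + 4) < r + s + t := by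
    intro r s t hrst
    have hsq : (r + s + t) ^ 2 < (b + 4 : ℤ) ^ 2 := by
      zify at hlower
      nlinarith [sq_nonneg (r - s), sq_nonneg (r - t), sq_nonneg (s - t)]
    exact (abs_lt_of_sq_lt_sq' hsq (by positivity)).1
  have hnat : ∀ r s t : ℤ, r ^ 2 + s ^ 2 + t ^ 2 = 4 * a - b ^ 2 → 4 ∣ b + r + s + t →
      ∃ x : ℕ, 4 * (x : ℤ) = b + r + s + t := by
    intro r s t hrst hdvd
    have := hlt r s t hrst
    exact ⟨((b + r + s + t) / 4).toNat, by omega⟩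
  obtain ⟨x, hx⟩ := hnat u v w h hdvd
  obtain ⟨y, hy⟩ := hnat u (-v) (-w) (by linarith) (by grind)
  obtain ⟨z, hz⟩ := hnat (-u) v (-w) (by linarith) (by grind)
  obtain ⟨t, ht⟩ := hnat (-u) (-v) w (by linarith) (by grind)
  refine ⟨x, y, z, t, ?_, by omega⟩
  have hsq : 16 * (x ^ 2 + y ^ 2 + z ^ 2 + t ^ 2 : ℤ) = 16 * a := by
    calc 16 * (x ^ 2 + y ^ 2 + z ^ 2 + t ^ 2 : ℤ)
        = (4 * x) ^ 2 + (4 * y) ^ 2 + (4 * z) ^ 2 + (4 * t) ^ 2 := by ring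
      _ = 4 * (b ^ 2 + (u ^ 2 + v ^ 2 + w ^ 2)) := by rw [hx, hy, hz, ht]; ring
      _ = 16 * a := by rw [h]; ring
  exact_mod_cast mul_left_cancel₀ (by norm_num) hsq

/-- `A` and `b` are the values of `∑ xᵢ.choose 2` and `∑ xᵢ` at a common vector of four natural
numbers `xᵢ`. Since the `m`-gonal numbers are the `(m - 2) * x.choose 2 + x`, the number
`(m - 2) * A + b` is then a sum of four of them. -/
def IsChooseSum (A b : ℕ) : Prop :=
  ∃ x y z w : ℕ, x.choose 2 + y.choose 2 + z.choose 2 + w.choose 2 = A ∧ x + y + z + w = b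

theorem isChooseSum_odd {A j : ℕ} (hlower : 3 * A < 2 * j ^ 2 + j + 2)
    (hupper : j ^ 2 ≤ 2 * A + j) : IsChooseSum A (2 * j + 1) := by
  obtain ⟨x, y, z, w, hsq, hsum⟩ := exists_sum_four_squares_and_sum_eq
    (a := 2 * A + (2 * j + 1)) (b := 2 * j + 1) ⟨A + j, by ring⟩ ⟨j, rfl⟩ (by linarith)
    (by linarith)
  simp only [← two_mul_choose_two_add] at hsq
  exact ⟨x, y, z, w, by omega, hsum⟩

theorem exists_three_mul_lt (A : ℕ) : ∃ j, 3 * A < 2 * j ^ 2 + j + 2 := ⟨3 * A, by nlinarith⟩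

/-- The least `j` for which `b = 2 * j + 1` satisfies the lower bound on `b` in Cauchy's lemma for
`a = 2 * A + b`. -/
def cauchyIndex (A : ℕ) : ℕ := Nat.find (exists_three_mul_lt A)

theorem cauchyIndex_le_iff {A j : ℕ} : cauchyIndex A ≤ j ↔ 3 * A < 2 * j ^ 2 + j + 2 := by
  refine ⟨fun h => ?_, fun h => Nat.find_min' _ h⟩
  have hfind : 3 * A < 2 * cauchyIndex A ^ 2 + cauchyIndex A + 2 :=
    Nat.find_spec (exists_three_mul_lt A)
  have := Nat.pow_le_pow_left h 2
  omega

theorem cauchyIndex_mono : Monotone cauchyIndex := by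
  intro A B hAB
  have := cauchyIndex_le_iff.mp (le_refl (cauchyIndex B))
  exact cauchyIndex_le_iff.mpr (by omega)

theorem cauchyIndex_zero : cauchyIndex 0 = 0 :=
  Nat.le_zero.mp (cauchyIndex_le_iff.mpr (by norm_num))

theorem cauchyIndex_succ_pos (A : ℕ) : 0 < cauchyIndex (A + 1) := by
  by_contra! h
  have := cauchyIndex_le_iff.mp h
  omega

theorem le_three_mul_of_lt_cauchyIndex {A l : ℕ} (hl : l < cauchyIndex A) :
    2 * l ^ 2 + l + 2 ≤ 3 * A := by
  simpa only [cauchyIndex_le_iff, not_lt] using hl.not_ge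

theorem sq_le_of_le_cauchyIndex_succ {A i : ℕ} (hi : i ≤ cauchyIndex (A + 1)) :
    i ^ 2 ≤ 2 * A + i := by
  rcases i with _ | l
  · simp
  have := le_three_mul_of_lt_cauchyIndex (Nat.lt_of_succ_le hi)
  rcases Nat.lt_or_ge l 2 with h | h
  · interval_cases l <;> omega
  · nlinarith

theorem isChooseSum_odd_of_le_cauchyIndex {A i : ℕ} (hi : cauchyIndex A ≤ i)
    (hi' : i ≤ cauchyIndex (A + 1)) : IsChooseSum A (2 * i + 1) :=
  isChooseSum_odd (cauchyIndex_le_iff.mp hi) (sq_le_of_le_cauchyIndex_succ hi')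

theorem isChooseSum_even {A j : ℕ} (h₁ : 2 * j ^ 2 ≤ 3 * A + 3 * j)
    (h₂ : 2 * A < j ^ 2 + j) :
    IsChooseSum A (2 * j + 2) ∨ IsChooseSum (A + 1) (2 * j) := by
  have hj9 : j < 9 := by nlinarith
  interval_cases j
  · omega
  · obtain rfl : A = 0 := by omega
    exact .inl ⟨1, 1, 1, 1, rfl, rfl⟩
  · obtain rfl | rfl : A = 1 ∨ A = 2 := by omega
    exacts [.inr ⟨0, 0, 2, 2, rfl, rfl⟩, .inl ⟨1, 1, 2, 2, rfl, rfl⟩]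
  · obtain rfl | rfl | rfl : A = 3 ∨ A = 4 ∨ A = 5 := by omega
    exacts [.inr ⟨0, 1, 2, 3, rfl, rfl⟩, .inl ⟨2, 2, 2, 2, rfl, rfl⟩, .inl ⟨1, 2, 2, 3, rfl, rfl⟩]
  · obtain rfl | rfl | rfl : A = 7 ∨ A = 8 ∨ A = 9 := by omega
    exacts [.inr ⟨0, 2, 2, 4, rfl, rfl⟩, .inl ⟨2, 2, 3, 3, rfl, rfl⟩, .inl ⟨1, 3, 3, 3, rfl, rfl⟩]
  · obtain rfl | rfl | rfl : A = 12 ∨ A = 13 ∨ A = 14 := by omega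
    exacts [.inl ⟨3, 3, 3, 3, rfl, rfl⟩, .inl ⟨2, 3, 3, 4, rfl, rfl⟩, .inl ⟨2, 2, 4, 4, rfl, rfl⟩]
  · obtain rfl | rfl | rfl : A = 18 ∨ A = 19 ∨ A = 20 := by omega
    exacts [.inl ⟨3, 3, 4, 4, rfl, rfl⟩, .inl ⟨2, 4, 4, 4, rfl, rfl⟩, .inl ⟨2, 3, 4, 5, rfl, rfl⟩]
  · obtain rfl | rfl : A = 26 ∨ A = 27 := by omega
    exacts [.inl ⟨3, 3, 5, 5, rfl, rfl⟩, .inl ⟨2, 4, 5, 5, rfl, rfl⟩]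
  · obtain rfl : A = 35 := by omega
    exact .inr ⟨0, 4, 6, 6, rfl, rfl⟩

theorem isChooseSum_cauchyIndex_succ (A : ℕ) :
    IsChooseSum A (2 * cauchyIndex (A + 1) + 2) ∨ IsChooseSum (A + 1) (2 * cauchyIndex (A + 1)) ∨
      IsChooseSum A (2 * cauchyIndex (A + 1) + 3) := by
  have hspec := cauchyIndex_le_iff.mp (le_refl (cauchyIndex (A + 1)))
  obtain ⟨l, hl⟩ := Nat.exists_eq_add_of_lt (cauchyIndex_succ_pos A)
  have hmin := le_three_mul_of_lt_cauchyIndex (A := A + 1) (l := l) (by omega)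
  rw [zero_add] at hl
  rw [hl] at hspec ⊢
  by_cases h : 2 * A < (l + 1) ^ 2 + (l + 1)
  · exact (isChooseSum_even (by nlinarith) h).imp_right .inl
  · exact .inr (.inr (isChooseSum_odd (j := l + 1 + 1) (by nlinarith) (by nlinarith)))

theorem exists_isChooseSum {k : ℕ} (hk : 3 ≤ k) (M : ℕ) :
    ∃ A b r, IsChooseSum A b ∧ r + 2 ≤ k ∧ k * A + b + r = M := by
  rcases Nat.eq_zero_or_pos M with rfl | hM
  · exact ⟨0, 0, 0, ⟨0, 0, 0, 0, rfl, rfl⟩, by omega, by simp⟩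
  obtain ⟨A, hA, hA'⟩ : ∃ A, k * A + (2 * cauchyIndex A + 1) ≤ M ∧
      M < k * (A + 1) + (2 * cauchyIndex (A + 1) + 1) := by
    by_contra! hcon
    have hle : ∀ A, k * A + (2 * cauchyIndex A + 1) ≤ M := by
      intro A
      induction A with
      | zero => rw [cauchyIndex_zero]; omega
      | succ A ih => exact hcon A ih
    nlinarith [hle M]
  have hmono : cauchyIndex A ≤ cauchyIndex (A + 1) := cauchyIndex_mono A.le_succ
  rw [mul_add] at hA'
  obtain ⟨t, rfl⟩ := Nat.exists_eq_add_of_le hA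
  by_cases h₁ : 2 * cauchyIndex A + t ≤ 2 * cauchyIndex (A + 1)
  · exact ⟨A, 2 * (cauchyIndex A + t / 2) + 1, t % 2,
      isChooseSum_odd_of_le_cauchyIndex (by omega) (by omega), by omega, by omega⟩
  by_cases h₂ : 2 * cauchyIndex A + t + 2 ≤ 2 * cauchyIndex (A + 1) + k
  · exact ⟨A, _, 2 * cauchyIndex A + t - 2 * cauchyIndex (A + 1),
      isChooseSum_odd_of_le_cauchyIndex hmono le_rfl, by omega, by omega⟩
  -- The only number left is `k * (A + 1) + 2 * cauchyIndex (A + 1)`.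
  rcases isChooseSum_cauchyIndex_succ A with h | h | h
  · exact ⟨A, _, k - 2, h, by omega, by omega⟩
  · exact ⟨A + 1, _, 0, h, by omega, by rw [mul_add]; omega⟩
  · exact ⟨A, _, k - 3, h, by omega, by omega⟩

theorem mem_polygonalNumbers {k N : ℕ} :
    N ∈ polygonalNumbers (k + 2) ↔ ∃ x : ℕ, N = k * x.choose 2 + x := by
  refine exists_congr fun x => ?_
  have hchoose : (2 * (x.choose 2 : ℚ) + x) = x ^ 2 := mod_cast two_mul_choose_two_add x
  rw [show (((k + 2 : ℕ) : ℚ) - 2) * (x : ℚ) ^ 2 - (((k + 2 : ℕ) : ℚ) - 4) * (x : ℚ) =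
    2 * ((k * x.choose 2 + x : ℕ) : ℚ) by push_cast; linear_combination -(k : ℚ) * hchoose,
    mul_div_cancel_left₀ _ two_ne_zero, Nat.cast_inj]

/-- Every natural number is a sum of `g` elements of `S`: the set `S` is an additive basis of
order `g`. -/
def IsBasisOfOrder (S : Set ℕ) (g : ℕ) : Prop :=
  ∀ M, ∃ l : List ℕ, (∀ s ∈ l, s ∈ S) ∧ l.length = g ∧ l.sum = M

theorem isBasisOfOrder_polygonalNumbers_three : IsBasisOfOrder (polygonalNumbers 3) 3 := by
  intro M
  obtain ⟨x, y, z, h⟩ := exists_sum_three_triangular M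
  have hmem : ∀ x : ℕ, (x + 1).choose 2 ∈ polygonalNumbers 3 := fun x =>
    mem_polygonalNumbers.mpr ⟨x, by rw [Nat.choose_succ_succ', Nat.choose_one_right]; ring⟩
  exact ⟨[(x + 1).choose 2, (y + 1).choose 2, (z + 1).choose 2], by simp [hmem], rfl,
    by simpa [add_assoc] using h⟩

theorem isBasisOfOrder_polygonalNumbers_four : IsBasisOfOrder (polygonalNumbers 4) 4 := by
  intro M
  obtain ⟨x, y, z, w, h⟩ := Nat.sum_four_squares M
  have hmem : ∀ x : ℕ, x ^ 2 ∈ polygonalNumbers 4 := fun x =>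
    mem_polygonalNumbers.mpr ⟨x, (two_mul_choose_two_add x).symm⟩
  exact ⟨[x ^ 2, y ^ 2, z ^ 2, w ^ 2], by simp [hmem], rfl, by simpa [add_assoc] using h⟩

theorem zero_mem_polygonalNumbers (m : ℕ) : 0 ∈ polygonalNumbers m := ⟨0, by simp⟩

theorem one_mem_polygonalNumbers (m : ℕ) : 1 ∈ polygonalNumbers m := ⟨1, by push_cast; ring⟩

theorem two_notMem_polygonalNumbers {m : ℕ} (hm : 3 ≤ m) : 2 ∉ polygonalNumbers m := by
  obtain ⟨k, rfl⟩ : ∃ k, m = k + 2 := ⟨m - 2, by omega⟩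
  rw [mem_polygonalNumbers]
  rintro ⟨x, hx⟩
  have h2 : 2 ≤ x := by
    by_contra! h
    interval_cases x <;> simp at hx
  have := Nat.choose_pos h2
  nlinarith

/-- **Fermat's polygonal number theorem**. -/
theorem isBasisOfOrder_polygonalNumbers {m : ℕ} (hm : 3 ≤ m) :
    IsBasisOfOrder (polygonalNumbers m) m := by
  obtain rfl | rfl | hm5 : m = 3 ∨ m = 4 ∨ 5 ≤ m := by omega
  · exact isBasisOfOrder_polygonalNumbers_three
  · exact isBasisOfOrder_polygonalNumbers_four
  obtain ⟨k, rfl⟩ : ∃ k, m = k + 2 := ⟨m - 2, by omega⟩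
  intro M
  obtain ⟨A, b, r, ⟨x, y, z, w, rfl, rfl⟩, hr, rfl⟩ := exists_isChooseSum (k := k) (by omega) M
  have hmem : ∀ x : ℕ, k * x.choose 2 + x ∈ polygonalNumbers (k + 2) :=
    fun x => mem_polygonalNumbers.mpr ⟨x, rfl⟩
  refine ⟨[x, y, z, w].map (fun x => k * x.choose 2 + x) ++
    (List.replicate r 1 ++ List.replicate (k - 2 - r) 0), ?_, ?_, ?_⟩
  · simp only [List.mem_append, List.mem_map, List.mem_replicate]
    rintro s (⟨x, -, rfl⟩ | ⟨-, rfl⟩ | ⟨-, rfl⟩)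
    exacts [hmem x, one_mem_polygonalNumbers _, zero_mem_polygonalNumbers _]
  · simp only [List.length_append, List.length_map, List.length_cons, List.length_nil,
      List.length_replicate]
    omega
  · simp only [List.map_cons, List.map_nil, List.sum_append, List.sum_cons, List.sum_nil,
      List.sum_replicate, smul_eq_mul]
    ring

section Representation

variable {S : Set ℕ}

theorem mem_V_nil {N : ℕ} : N ∈ V S [] ↔ N = 0 := by
  simp [V]

theorem mem_V_cons {c N : ℕ} {a : List ℕ} :
    N ∈ V S (c :: a) ↔ ∃ s ∈ S, ∃ N' ∈ V S a, N = c * s + N' := by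
  constructor
  · rintro ⟨s, hs, rfl⟩
    exact ⟨s 0, hs 0, ∑ i : Fin a.length, a.get i * s i.succ, ⟨_, fun i => hs _, rfl⟩,
      Fin.sum_univ_succ fun i : Fin (a.length + 1) => (c :: a).get i * s i⟩
  · rintro ⟨s, hs, _, ⟨t, ht, rfl⟩, rfl⟩
    exact ⟨Fin.cons s t, Fin.cases hs ht, (Fin.sum_univ_succ fun i : Fin (a.length + 1) =>
      (c :: a).get i * (Fin.cons s t : Fin (a.length + 1) → ℕ) i).symm⟩

theorem V_perm {a b : List ℕ} (h : a.Perm b) : V S a = V S b := by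
  induction h with
  | nil => rfl
  | cons c _ ih => ext N; simp only [mem_V_cons, ih]
  | swap c d l =>
    ext N
    simp only [mem_V_cons]
    constructor <;>
    · rintro ⟨s, hs, _, ⟨t, ht, N', hN', rfl⟩, rfl⟩
      exact ⟨t, ht, _, ⟨s, hs, N', hN', rfl⟩, by ring⟩
  | trans _ _ ih₁ ih₂ => exact ih₁.trans ih₂

theorem add_mem_V_append {a b : List ℕ} {M N : ℕ} (hM : M ∈ V S a) (hN : N ∈ V S b) :
    M + N ∈ V S (a ++ b) := by
  induction a generalizing M with
  | nil => rwa [mem_V_nil.mp hM, zero_add]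
  | cons c a ih =>
    obtain ⟨s, hs, M', hM', rfl⟩ := mem_V_cons.mp hM
    exact mem_V_cons.mpr ⟨s, hs, M' + N, ih hM', add_assoc ..⟩

theorem zero_mem_V (h0 : 0 ∈ S) (a : List ℕ) : 0 ∈ V S a := by
  induction a with
  | nil => exact mem_V_nil.mpr rfl
  | cons c a ih => exact mem_V_cons.mpr ⟨0, h0, 0, ih, by simp⟩

theorem sum_mem_V (h1 : 1 ∈ S) (a : List ℕ) : a.sum ∈ V S a := by
  induction a with
  | nil => exact mem_V_nil.mpr rfl
  | cons c a ih => exact mem_V_cons.mpr ⟨1, h1, a.sum, ih, by simp⟩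

theorem V_subset_of_subperm (h0 : 0 ∈ S) {a b : List ℕ} (h : a.Subperm b) : V S a ⊆ V S b := by
  obtain ⟨a', ha', hsub⟩ := h
  obtain ⟨d, hd⟩ := hsub.exists_perm_append
  intro N hN
  rw [V_perm hd, ← add_zero N]
  exact add_mem_V_append (V_perm ha' ▸ hN) (zero_mem_V h0 d)

theorem sum_mem_V_of_subperm (h0 : 0 ∈ S) (h1 : 1 ∈ S) {a b : List ℕ} (h : a.Subperm b) :
    a.sum ∈ V S b :=
  V_subset_of_subperm h0 h (sum_mem_V h1 a)

theorem mul_sum_mem_V_flatMap (h0 : 0 ∈ S) {c : ℕ} {J l : List ℕ} (hJ : ∀ i ∈ J, i ≤ c)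
    (hl : ∀ s ∈ l, s ∈ S) (hlen : l.length ≤ J.length) :
    c * l.sum ∈ V S (J.flatMap fun i => [i, c - i]) := by
  induction J generalizing l with
  | nil => simp [List.eq_nil_of_length_eq_zero (Nat.le_zero.mp hlen), mem_V_nil]
  | cons i J ih =>
    cases l with
    | nil => exact zero_mem_V h0 _
    | cons s l =>
      obtain ⟨hi, hJ⟩ := List.forall_mem_cons.mp hJ
      obtain ⟨hs, hl⟩ := List.forall_mem_cons.mp hl
      have ih := ih hJ hl (Nat.le_of_succ_le_succ hlen)
      refine mem_V_cons.mpr ⟨s, hs, _, mem_V_cons.mpr ⟨s, hs, _, ih, rfl⟩, ?_⟩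
      rw [← add_assoc, ← add_mul, Nat.add_sub_cancel' hi, List.sum_cons, mul_add]

theorem nodup_flatMap_pair {c : ℕ} {J : List ℕ} (hJ : J.Nodup) (hlt : ∀ i ∈ J, 2 * i < c) :
    (J.flatMap fun i => [i, c - i]).Nodup := by
  refine List.nodup_flatMap.mpr ⟨fun i hi => ?_, hJ.imp_of_mem fun {i j} hi hj hij => ?_⟩
  · have := hlt i hi
    simpa using (by omega : i ≠ c - i)
  · have := hlt i hi
    have := hlt j hj
    simp only [Function.onFun, List.disjoint_cons_left, List.mem_pair, List.disjoint_nil_left,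
      and_true]
    omega

/-- Giving the weights `i` and `c - i` the same multiplier `s` contributes `c * s`. -/
theorem IsBasisOfOrder.mul_mem_V {g : ℕ} (hS : IsBasisOfOrder S g) (h0 : 0 ∈ S) {c : ℕ}
    {J A : List ℕ} (hJ : J.Nodup) (hlt : ∀ i ∈ J, 2 * i < c) (hA : ∀ i ∈ J, i ∈ A ∧ c - i ∈ A)
    (hg : g ≤ J.length) (M : ℕ) : c * M ∈ V S A := by
  obtain ⟨l, hl, hlen, rfl⟩ := hS M
  have hsubset : (J.flatMap fun i => [i, c - i]) ⊆ A := by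
    intro x hx
    obtain ⟨i, hi, hx⟩ := List.mem_flatMap.mp hx
    rcases List.mem_pair.mp hx with rfl | rfl
    exacts [(hA _ hi).1, (hA _ hi).2]
  exact V_subset_of_subperm h0 (List.subperm_of_subset (nodup_flatMap_pair hJ hlt) hsubset)
    (mul_sum_mem_V_flatMap h0 (fun i hi => by have := hlt i hi; omega) hl (hlen.trans_le hg))

theorem IsBasisOfOrder.mul_add_mem_V {g : ℕ} (hS : IsBasisOfOrder S g) (h0 : 0 ∈ S) (h1 : 1 ∈ S)
    {c u : ℕ} {J A : List ℕ} (hJ : J.Nodup) (hlt : ∀ i ∈ J, 2 * i < c)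
    (hA : ∀ i ∈ J, i ∈ A ∧ c - i ∈ A) (hu : u ∈ A) (hg : g + 1 ≤ J.length) (M : ℕ) :
    c * M + u ∈ V S A := by
  have hmul : c * M ∈ V S (A.erase u) := by
    refine hS.mul_mem_V h0 (J := J.erase (min u (c - u))) (hJ.erase _)
      (fun i hi => hlt i (List.mem_of_mem_erase hi)) (fun i hi => ?_) ?_ M
    · obtain ⟨hne, hi⟩ := hJ.mem_erase_iff.mp hi
      have := hlt i hi
      exact ⟨(List.mem_erase_of_ne (by omega)).mpr (hA i hi).1,
        (List.mem_erase_of_ne (by omega)).mpr (hA i hi).2⟩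
    · exact (Nat.le_sub_of_add_le hg).trans List.le_length_erase
  rw [V_perm (List.perm_cons_erase hu)]
  exact mem_V_cons.mpr ⟨1, h1, c * M, hmul, by ring⟩

theorem IsBasisOfOrder.mem_V_append_range' {g n : ℕ} (hS : IsBasisOfOrder S g) (h0 : 0 ∈ S)
    (h1 : 1 ∈ S) (hn : 2 * g + 3 ≤ n) {e : List ℕ} (he₁ : n ∈ V S e) (he₂ : 2 * n ∈ V S e)
    {N : ℕ} (hN : n ≤ N) : N ∈ V S (e ++ List.range' (n + 1) (n - 1)) := by
  have hlt : ∀ i ∈ List.range' (n + 1) ((n - 1) / 2), 2 * i < 3 * n := by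
    simp only [List.mem_range'_1]
    omega
  have hmem : ∀ i ∈ List.range' (n + 1) ((n - 1) / 2),
      i ∈ List.range' (n + 1) (n - 1) ∧ 3 * n - i ∈ List.range' (n + 1) (n - 1) := by
    simp only [List.mem_range'_1]
    omega
  have hlen : g + 1 ≤ (List.range' (n + 1) ((n - 1) / 2)).length := by
    rw [List.length_range']
    omega
  have he : ∀ i < 3, n * i ∈ V S e := by
    intro i hi
    interval_cases i
    exacts [zero_mem_V h0 e, (mul_one n).symm ▸ he₁, mul_comm 2 n ▸ he₂]
  have hdivmod : ∀ q : ℕ, ∃ i < 3, ∃ M, q = i + 3 * M := fun q =>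
    ⟨q % 3, by omega, q / 3, by omega⟩
  obtain ⟨q, r, hr, rfl⟩ : ∃ q r, r < n ∧ N = n * q + r :=
    ⟨N / n, N % n, Nat.mod_lt N (by omega), (Nat.div_add_mod N n).symm⟩
  rcases Nat.eq_zero_or_pos r with rfl | hr0
  · obtain ⟨i, hi, M, rfl⟩ := hdivmod q
    rw [show n * (i + 3 * M) + 0 = n * i + 3 * n * M by ring]
    exact add_mem_V_append (he i hi)
      (hS.mul_mem_V h0 List.nodup_range' hlt hmem (by omega) M)
  · obtain ⟨q, rfl⟩ : ∃ q', q = q' + 1 := Nat.exists_eq_succ_of_ne_zero (by rintro rfl; omega)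
    obtain ⟨i, hi, M, rfl⟩ := hdivmod q
    rw [show n * (i + 3 * M + 1) + r = n * i + (3 * n * M + (n + r)) by ring]
    exact add_mem_V_append (he i hi) (hS.mul_add_mem_V h0 h1 List.nodup_range' hlt hmem
      (List.mem_range'_1.mpr (by omega)) hlen M)

theorem exists_sublist_sum_eq (h2 : 2 ∉ S) {a : List ℕ} {n N : ℕ} (ha : ∀ c ∈ a, n ≤ c)
    (hN : N ∈ V S a) (hlt : N < 3 * n) : ∃ b : List ℕ, b.Sublist a ∧ b.sum = N := by
  induction a generalizing N with
  | nil => exact ⟨[], .slnil, (mem_V_nil.mp hN).symm⟩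
  | cons c a ih =>
    obtain ⟨s, hs, N', hN', rfl⟩ := mem_V_cons.mp hN
    obtain ⟨hc, ha⟩ := List.forall_mem_cons.mp ha
    obtain ⟨b, hb, hsum⟩ := ih ha hN' (by omega)
    have hs2 : s ≠ 2 := fun h => h2 (h ▸ hs)
    have hs3 : s < 3 := by
      by_contra! h
      nlinarith
    obtain rfl | rfl : s = 0 ∨ s = 1 := by omega
    · exact ⟨b, hb.cons c, by simp [hsum]⟩
    · exact ⟨c :: b, hb.cons_cons c, by simp [hsum]⟩

theorem mul_length_le_sum {n : ℕ} {b : List ℕ} (hb : ∀ c ∈ b, n ≤ c) : n * b.length ≤ b.sum := by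
  simpa [mul_comm] using List.card_nsmul_le_sum b n hb

theorem le_of_mem_V (h2 : 2 ∉ S) {a : List ℕ} {n N : ℕ} (ha : ∀ c ∈ a, n ≤ c) (hN : N ∈ V S a)
    (hN0 : N ≠ 0) : n ≤ N := by
  by_contra! hlt
  obtain ⟨b, hb, rfl⟩ := exists_sublist_sum_eq h2 ha hN (by omega)
  have hlen := mul_length_le_sum fun c hc => ha c (hb.subset hc)
  cases b with
  | nil => exact hN0 rfl
  | cons c b => rw [List.length_cons] at hlen; nlinarith

theorem mem_of_mem_V (h2 : 2 ∉ S) {a : List ℕ} {n N : ℕ} (ha : ∀ c ∈ a, n ≤ c) (hN : N ∈ V S a)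
    (hN0 : N ≠ 0) (hlt : N < 2 * n) : N ∈ a := by
  obtain ⟨b, hb, rfl⟩ := exists_sublist_sum_eq h2 ha hN (by omega)
  have hlen := mul_length_le_sum fun c hc => ha c (hb.subset hc)
  match b with
  | [] => exact absurd rfl hN0
  | [c] => simpa using hb.subset
  | c :: d :: b => simp only [List.length_cons] at hlen; nlinarith

theorem two_mul_mem_or_pair_sublist (h2 : 2 ∉ S) {a : List ℕ} {n : ℕ} (hn : 0 < n)
    (ha : ∀ c ∈ a, n ≤ c) (hN : 2 * n ∈ V S a) : 2 * n ∈ a ∨ [n, n].Sublist a := by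
  obtain ⟨b, hb, hsum⟩ := exists_sublist_sum_eq h2 ha hN (by omega)
  have hle : ∀ c ∈ b, n ≤ c := fun c hc => ha c (hb.subset hc)
  have hlen := mul_length_le_sum hle
  match b with
  | [] => rw [List.sum_nil] at hsum; omega
  | [c] =>
    obtain rfl : c = 2 * n := by simpa using hsum
    exact .inl (by simpa using hb.subset)
  | [c, d] =>
    have := hle c (by simp)
    have := hle d (by simp)
    have : c + d = 2 * n := by simpa using hsum
    obtain rfl : c = n := by omega
    obtain rfl : d = c := by omega
    exact .inr hb
  | c :: d :: f :: b => simp only [List.length_cons] at hlen; nlinarith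

end Representation

section TightUniversal

variable {m n : ℕ}

theorem isTightUniversal_of_forall_mem (hm : 3 ≤ m) (hn : 0 < n) {a : List ℕ}
    (ha : ∀ c ∈ a, n ≤ c) (h : ∀ N, n ≤ N → N ∈ V (polygonalNumbers m) a) :
    IsTightUniversal m n a :=
  ⟨fun c hc => hn.trans_le (ha c hc), Set.Subset.antisymm
    (fun _ hN => le_of_mem_V (two_notMem_polygonalNumbers hm) ha hN.1 hN.2)
    fun N hN => ⟨h N hN, (hn.trans_le hN).ne'⟩⟩

theorem isTightUniversal_append_range' (hm : 3 ≤ m) (hn : 2 * m + 3 ≤ n) {e : List ℕ}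
    (he : ∀ c ∈ e, n ≤ c) (he₁ : n ∈ V (polygonalNumbers m) e)
    (he₂ : 2 * n ∈ V (polygonalNumbers m) e) :
    IsTightUniversal m n (e ++ List.range' (n + 1) (n - 1)) := by
  refine isTightUniversal_of_forall_mem hm (by omega) (fun c hc => ?_) fun N hN =>
    (isBasisOfOrder_polygonalNumbers hm).mem_V_append_range' (zero_mem_polygonalNumbers m)
      (one_mem_polygonalNumbers m) hn he₁ he₂ hN
  rcases List.mem_append.mp hc with hc | hc
  · exact he c hc
  · rw [List.mem_range'_1] at hc
    omega

theorem IsTightUniversal.perm {a b : List ℕ} (ha : IsTightUniversal m n a) (h : a.Perm b) :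
    IsTightUniversal m n b :=
  ⟨fun c hc => ha.1 c (h.mem_iff.mpr hc), by rw [V', ← V_perm h]; exact ha.2⟩

theorem xVec_eq_append (hn : 0 < n) : xVec n = [n, n] ++ List.range' (n + 1) (n - 1) := by
  obtain ⟨k, rfl⟩ := Nat.exists_eq_add_of_lt hn
  simp [xVec, List.range'_succ]

theorem yVec_perm_append (hn : 0 < n) :
    (yVec n).Perm ([n, 2 * n] ++ List.range' (n + 1) (n - 1)) := by
  obtain ⟨k, rfl⟩ := Nat.exists_eq_add_of_lt hn
  rw [yVec, List.range'_succ, List.range'_1_concat, Nat.add_sub_cancel,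
    show 0 + k + 1 + 1 + (0 + k) = 2 * (0 + k + 1) by ring]
  exact (List.perm_append_singleton _ _).cons _

theorem isTightUniversal_xVec (hm : 3 ≤ m) (hn : 2 * m + 3 ≤ n) :
    IsTightUniversal m n (xVec n) := by
  have h0 := zero_mem_polygonalNumbers m
  have h1 := one_mem_polygonalNumbers m
  rw [xVec_eq_append (by omega)]
  refine isTightUniversal_append_range' hm hn (by simp) ?_ ?_
  · simpa using sum_mem_V_of_subperm h0 h1 (a := [n]) (b := [n, n]) (by simp)
  · simpa [two_mul] using sum_mem_V h1 [n, n]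

theorem isTightUniversal_yVec (hm : 3 ≤ m) (hn : 2 * m + 3 ≤ n) :
    IsTightUniversal m n (yVec n) := by
  have h0 := zero_mem_polygonalNumbers m
  have h1 := one_mem_polygonalNumbers m
  refine IsTightUniversal.perm ?_ (yVec_perm_append (by omega)).symm
  refine isTightUniversal_append_range' hm hn (by simp; omega) ?_ ?_
  · simpa using sum_mem_V_of_subperm h0 h1 (a := [n]) (b := [n, 2 * n]) (by simp)
  · simpa using sum_mem_V_of_subperm h0 h1 (a := [2 * n]) (b := [n, 2 * n]) (by simp)

theorem IsTightUniversal.le_of_mem {a : List ℕ} (ha : IsTightUniversal m n a) {c : ℕ}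
    (hc : c ∈ a) : n ≤ c := by
  have hV : c ∈ V (polygonalNumbers m) a := by
    simpa using sum_mem_V_of_subperm (zero_mem_polygonalNumbers m) (one_mem_polygonalNumbers m)
      (List.singleton_subperm_iff.mpr hc)
  exact ha.2.subset ⟨hV, (ha.1 c hc).ne'⟩

theorem IsTightUniversal.subperm (hm : 3 ≤ m) (hn : 0 < n) {a : List ℕ}
    (ha : IsTightUniversal m n a) : (xVec n).Subperm a ∨ (yVec n).Subperm a := by
  have h2 := two_notMem_polygonalNumbers hm
  have hle : ∀ c ∈ a, n ≤ c := fun c => ha.le_of_mem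
  have hV : ∀ N, n ≤ N → N ∈ V (polygonalNumbers m) a := fun N hN => (ha.2.superset hN).1
  have hmem : ∀ N, n ≤ N → N < 2 * n → N ∈ a := fun N hN =>
    mem_of_mem_V h2 hle (hV N hN) (hn.trans_le hN).ne'
  rcases two_mul_mem_or_pair_sublist h2 hn hle (hV (2 * n) (by omega)) with h2n | hnn
  · right
    refine List.subperm_of_subset List.nodup_range' fun i hi => ?_
    obtain ⟨hi, hi'⟩ := List.mem_range'_1.mp hi
    obtain hlt | rfl : i < 2 * n ∨ i = 2 * n := by omega
    exacts [hmem i hi hlt, h2n]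
  · left
    have hn_mem : n ∈ a.erase n := by simpa using (hnn.erase n).subset
    refine ((List.subperm_cons n).mpr ?_).trans
      (List.perm_cons_erase (List.mem_of_mem_erase hn_mem)).symm.subperm
    refine List.subperm_of_subset List.nodup_range' fun i hi => ?_
    obtain ⟨hi, hi'⟩ := List.mem_range'_1.mp hi
    rcases eq_or_ne i n with rfl | hne
    exacts [hn_mem, (List.mem_erase_of_ne hne).mpr (hmem i hi (by omega))]

theorem length_xVec : (xVec n).length = n + 1 := by simp [xVec]

theorem length_yVec : (yVec n).length = n + 1 := by simp [yVec]

theorem IsTightUniversal.isNew (hm : 3 ≤ m) (hn : 0 < n) {a : List ℕ}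
    (ha : IsTightUniversal m n a) (hlen : a.length = n + 1) : IsNewTightUniversal m n a := by
  refine ⟨ha, fun b hb htight => hb.2 (hb.1.eq_of_length_le ?_)⟩
  rw [hlen]
  rcases htight.subperm hm hn with h | h
  exacts [length_xVec.symm.trans_le h.length_le, length_yVec.symm.trans_le h.length_le]

theorem IsNewTightUniversal.perm_of_subperm {a b : List ℕ} (ha : IsNewTightUniversal m n a)
    (hb : IsTightUniversal m n b) (h : b.Subperm a) : a.Perm b := by
  obtain ⟨l, hl, hla⟩ := h
  by_cases hne : l = a
  · exact hne ▸ hl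
  · exact absurd (hb.perm hl.symm) (ha.2 l ⟨hla, hne⟩)

theorem not_xVec_perm_yVec (hn : 0 < n) : ¬ (xVec n).Perm (yVec n) := by
  intro h
  have hmem : 2 * n ∈ xVec n := h.mem_iff.mpr (List.mem_range'_1.mpr (by omega))
  rw [xVec, List.mem_cons, List.mem_range'_1] at hmem
  omega

end TightUniversal

end PolygonalSums

open PolygonalSums in
theorem mainTheorem7 (m n : ℕ) (hm : 3 ≤ m) (hn : 2 * m + 3 ≤ n) :
    PolygonalSums.IsNewTightUniversal m n (PolygonalSums.xVec n) ∧
    PolygonalSums.IsNewTightUniversal m n (PolygonalSums.yVec n) ∧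
    ¬ (PolygonalSums.xVec n).Perm (PolygonalSums.yVec n) ∧
    ∀ a : List ℕ, PolygonalSums.IsNewTightUniversal m n a ↔
      (a.Perm (PolygonalSums.xVec n) ∨ a.Perm (PolygonalSums.yVec n)) := by
  have hn0 : 0 < n := by omega
  have hx := isTightUniversal_xVec hm hn
  have hy := isTightUniversal_yVec hm hn
  refine ⟨hx.isNew hm hn0 length_xVec, hy.isNew hm hn0 length_yVec, not_xVec_perm_yVec hn0,
    fun a => ⟨fun ha => ?_, ?_⟩⟩
  · exact (ha.1.subperm hm hn0).imp (ha.perm_of_subperm hx) (ha.perm_of_subperm hy)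
  · rintro (h | h)
    · exact (hx.perm h.symm).isNew hm hn0 (h.length_eq.trans length_xVec)
    · exact (hy.perm h.symm).isNew hm hn0 (h.length_eq.trans length_yVec)
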